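/- Let $\mathbb S^1=\mathbb R/\mathbb Z$ with projection $e:\mathbb R\to\mathbb S^1$. A lifting of a circle map $g$ is a continuous $G:\mathbb R\to\mathbb R$ with $g\circ e=e\circ G$; $g$ has degree one if $G(x+1)=G(x)+1$, and $g$ is non-decreasing if it has a non-decreasing lifting. Let $f:\mathbb S^1\to\mathbb S^1$ be a continuous map of degree one with lifting $F$, and put $$\rho_F(x)=\limsup_{n\to\infty}\frac{F^n(x)-x}{n},\qquad \mathrm{Rot}(F)=\{\rho_F(x):x\in\mathbb R\},\qquad \mathrm{Rot}_I(F)=\mathrm{Rot}(F)\setminus\mathbb Q .$$ Let $\mathcal K\subset\mathbb R$ be a closed interval containing $0$ (bounded or unbounded; in particular $[0,\infty)$ and $\mathbb R$ are allowed), let $p:\mathcal K\to\mathcal K$ and $q:\mathbb S^1\to\mathbb R$ be continuous with $p(x)q(\theta)\in\mathcal K$ for all $x\in\mathcal K$, $\theta\in\mathbb S^1$, and let $T(\theta,x)=(f(\theta),p(x)q(\theta))$ on $\mathbb S^1\times\mathcal K$. Write $R_\rho(\theta)=\theta+\rho \pmod 1$, and call a set $A$ $g$-invariant if $g(A)=A$.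 Attracting sets. Let $g$ be a circle map and let $S$ be a skew-product on $\mathbb S^1\times\mathcal K$ over $g$. Let $U\subset\mathbb S^1$ be a measurable $g$-invariant set with $\mu(U)=1$ for some $g$-ergodic probability measure $\mu$, and let $\varphi$ be a correspondence (set-valued map) from $U$ to $\mathcal K$ whose graph $\mathrm{gr}(\varphi)=\{(\theta,x):\theta\in U,\ x\in\varphi(\theta)\}$ satisfies $S(\mathrm{gr}(\varphi))=\mathrm{gr}(\varphi)$. The closure of $\mathrm{gr}(\varphi)$ is an *attracting set of $S$ with support $U$ generated by $\varphi$* if for every $\theta\in U$ there is a measurable set $A\subset\mathcal K$ of positive Lebesgue measure such that for every $x\in A$ there is $z\in\varphi(\theta)$ with $\lim_{n\to\infty}\|S^n(\theta,x)-S^n(\theta,z)\|=0$. **Theorem.** To every $\rho\in\mathrm{Rot}_I(F)$ one can associate a measurable $f$-invariant set $\mathscr U_\rho\subset\mathbb S^1$, a continuous non-decreasing circle map $h_\rho$ of degree one and an $f$-ergodic probability measure $\mu_\rho$ such that $\mu_\rho(\mathscr U_\rho)=1$; $\rho_F(x)=\rho$ for every $x\in e^{-1}(\overline{\mathscr U_\rho})$;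 $h_\rho|_{\mathscr U_\rho}:\mathscr U_\rho\to h_\rho(\mathscr U_\rho)$ is a homeomorphism; $h_\rho(\mathscr U_\rho)$ is a dense $R_\rho$-invariant set; $h_\rho\circ f=R_\rho\circ h_\rho$ on $\mathscr U_\rho$; and the closures $\overline{\mathscr U_\rho}$, $\rho\in\mathrm{Rot}_I(F)$, are pairwise disjoint. Moreover: 1. Let $\rho\in\mathrm{Rot}_I(F)$ and $S_\rho(\theta,x)=\bigl(R_\rho(\theta),\,p(x)\,q(h_\rho^{-1}(\theta))\bigr)$, where $h_\rho^{-1}$ is, on $h_\rho(\mathscr U_\rho)$, the inverse of $h_\rho|_{\mathscr U_\rho}$ (its values elsewhere are irrelevant). If $S_\rho$ has an attracting set with support $h_\rho(\mathscr U_\rho)$ generated by a correspondence $\varphi_\rho$, then the closure of the graph of $\varphi_\rho\circ h_\rho$ is an attracting set of $T$ with support $\mathscr U_\rho$ generated by $\varphi_\rho\circ h_\rho$. 2. If for every $\rho\in\mathrm{Rot}_I(F)$ the system $S_\rho$ has an attracting set with support $h_\rho(\mathscr U_\rho)$, and $\mathrm{Rot}(F)$ is non-degenerate (has more than one point), then $T$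 has uncountably many coexisting, pairwise disjoint, attracting sets. -/

import Mathlib

open MeasureTheory Filter Topology

noncomputable section

/-- `F` is a lifting of the circle map `f`, where the circle is `ℝ / ℤ`, and it is a lifting of a
continuous map of degree one. -/
structure IsDegreeOneLift (f : UnitAddCircle → UnitAddCircle) (F : ℝ → ℝ) : Prop where
  continuous : Continuous F
  map_add_one : ∀ x : ℝ, F (x + 1) = F x + 1
  semiconj : ∀ x : ℝ, f (x : UnitAddCircle) = ((F x : ℝ) : UnitAddCircle)

/-- Continuous non-decreasing circle maps of degree one. -/
def IsNondecreasingDegreeOne (h : UnitAddCircle → UnitAddCircle) : Prop :=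
  Continuous h ∧ ∃ H : ℝ → ℝ, IsDegreeOneLift h H ∧ Monotone H

/-- The `F`-rotation number of `x`, `limsup (F^n x - x) / n`. For a lifting of degree one the
sequence is bounded, so this is the true upper limit. -/
def rotNumber (F : ℝ → ℝ) (x : ℝ) : ℝ :=
  limsup (fun n : ℕ => (F^[n] x - x) / (n : ℝ)) atTop

/-- The rotation set `Rot(F)`. -/
def rotSet (F : ℝ → ℝ) : Set ℝ := Set.range (rotNumber F)

/-- The set of irrational numbers in `Rot(F)`. -/
def irrRotSet (F : ℝ → ℝ) : Set ℝ := {ρ | ρ ∈ rotSet F ∧ Irrational ρ}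

/-- The rotation of the circle by the angle `ρ`. -/
def circleRot (ρ : ℝ) (θ : UnitAddCircle) : UnitAddCircle := θ + (ρ : UnitAddCircle)

/-- The skew-product `(θ, x) ↦ (g θ, p x * r θ)` on the cylinder `S¹ × K`. -/
def skewProduct {K : Set ℝ} (g : UnitAddCircle → UnitAddCircle) (p : K → K)
    (r : UnitAddCircle → ℝ) (hr : ∀ (θ : UnitAddCircle) (x : K), (p x : ℝ) * r θ ∈ K) :
    UnitAddCircle × K → UnitAddCircle × K :=
  fun z => (g z.1, ⟨(p z.2 : ℝ) * r z.1, hr z.1 z.2⟩)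

/-- The graph over `U` of a correspondence (set-valued map) `φ` from `U` to `K`.
Values of `φ` outside `U` play no role. -/
def corrGraph {K : Set ℝ} (U : Set UnitAddCircle) (φ : UnitAddCircle → Set K) :
    Set (UnitAddCircle × K) :=
  {z | z.1 ∈ U ∧ z.2 ∈ φ z.1}

/-- For a map `T` of the cylinder over the circle map `g`, the closure of the graph of `φ` over `U`
is an attracting set with support `U` and generated by `φ`. -/
structure GeneratesAttractingSet {K : Set ℝ} (g : UnitAddCircle → UnitAddCircle)
    (T : UnitAddCircle × K → UnitAddCircle × K)
    (U : Set UnitAddCircle) (φ : UnitAddCircle → Set K) : Prop where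
  measurableSet_support : MeasurableSet U
  image_support : g '' U = U
  exists_ergodic : ∃ μ : Measure UnitAddCircle, IsProbabilityMeasure μ ∧ Ergodic g μ ∧ μ U = 1
  image_graph : T '' corrGraph U φ = corrGraph U φ
  attracts : ∀ θ ∈ U, ∃ A : Set K, MeasurableSet A ∧ 0 < volume (Subtype.val '' A : Set ℝ) ∧
    ∀ x ∈ A, ∃ z ∈ φ θ,
      Tendsto (fun n : ℕ => dist (T^[n] (θ, x)) (T^[n] (θ, z))) atTop (𝓝 0)

/-- `A` is an attracting set of the map `T` of the cylinder over the circle map `g`. -/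
def IsAttractingSet {K : Set ℝ} (g : UnitAddCircle → UnitAddCircle)
    (T : UnitAddCircle × K → UnitAddCircle × K) (A : Set (UnitAddCircle × K)) : Prop :=
  ∃ (U : Set UnitAddCircle) (φ : UnitAddCircle → Set K),
    GeneratesAttractingSet g T U φ ∧ A = closure (corrGraph U φ)

/-- The skew-product `(θ, x) ↦ (θ + ρ, p x * q (h⁻¹ θ))`, where `h⁻¹` denotes on `h '' U` the inverse
of the restriction of `h` to `U`. Its value outside `h '' U` is arbitrary; it does not affect
attracting sets with support `h '' U`. -/
def rotationForced {K : Set ℝ} (ρ : ℝ) (p : K → K) (q : UnitAddCircle → ℝ)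
    (hpq : ∀ (θ : UnitAddCircle) (x : K), (p x : ℝ) * q θ ∈ K)
    (h : UnitAddCircle → UnitAddCircle) (U : Set UnitAddCircle) :
    UnitAddCircle × K → UnitAddCircle × K :=
  skewProduct (circleRot ρ) p (fun θ => q (Function.invFunOn h U θ))
    (fun θ x => hpq (Function.invFunOn h U θ) x)

end

/-! Cutting `F` off at height `t` above its greatest monotone minorant, then taking the least
monotone majorant, gives a continuous family of monotone degree one maps (`waterMap`). It starts
below `F`, ends above `F`, and each member is locally constant wherever it differs from `F`. The
rotation numbers of `F` lie between the translation numbers of the two extremes. By continuity in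
`t`, every value in between is the translation number of some member `G`.

For irrational `ρ`, `H x = limsup (G^n x - n ρ)` is a continuous monotone semiconjugacy from `G` to
translation by `ρ`. Discarding the countably many rotation orbits that meet a value with several
preimages leaves a conull invariant set `E`. Over `E` the induced circle map `h` is injective. There
also `F = G`, since a plateau of `G` is a plateau of `H`. So `U = h⁻¹(E)` carries a copy of the
rotation (`exists_isRotationFactor`), with Lebesgue measure pulled back to it. On the closure of `U`
still `F = G`, so the rotation number is `ρ`, which separates the closures for different `ρ`.

Finally `h × id` conjugates the skew-products over `U` without changing fibre coordinates, so
attraction transfers. A non-degenerate rotation set contains uncountably many irrationals. -/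

/-! ### Monotone envelopes of degree one maps. -/

/-- The running supremum over `[x - 1, x]`. For a continuous map of degree one it is the least
monotone majorant. -/
noncomputable def upperEnvelope (φ : ℝ → ℝ) (x : ℝ) : ℝ :=
  sSup ((fun s => φ (x - s)) '' Set.Icc 0 1)

/-- The running infimum over `[x, x + 1]`. For a continuous map of degree one it is the greatest
monotone minorant. -/
noncomputable def lowerEnvelope (φ : ℝ → ℝ) (x : ℝ) : ℝ :=
  sInf ((fun s => φ (x + s)) '' Set.Icc 0 1)

section Envelope

variable {φ : ℝ → ℝ}

theorem map_add_natCast_of_map_add_one (h1 : ∀ x, φ (x + 1) = φ x + 1) (x : ℝ) (n : ℕ) :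
    φ (x + n) = φ x + n := by
  induction n with
  | zero => simp
  | succ k ih => push_cast; rw [← add_assoc, h1, ih]; ring

theorem exists_eq_upperEnvelope (hc : Continuous φ) (x : ℝ) :
    ∃ y ∈ Set.Icc (x - 1) x, upperEnvelope φ x = φ y := by
  obtain ⟨s, hs, h, -⟩ := isCompact_Icc.exists_sSup_image_eq_and_ge (s := Set.Icc (0 : ℝ) 1)
    ⟨0, by simp⟩ (f := fun s => φ (x - s)) (by fun_prop)
  exact ⟨x - s, ⟨by linarith [hs.2], by linarith [hs.1]⟩, h⟩

theorem exists_eq_lowerEnvelope (hc : Continuous φ) (x : ℝ) :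
    ∃ y ∈ Set.Icc x (x + 1), lowerEnvelope φ x = φ y := by
  obtain ⟨s, hs, h, -⟩ := isCompact_Icc.exists_sInf_image_eq_and_le (s := Set.Icc (0 : ℝ) 1)
    ⟨0, by simp⟩ (f := fun s => φ (x + s)) (by fun_prop)
  exact ⟨x + s, ⟨by linarith [hs.1], by linarith [hs.2]⟩, h⟩

/-- A window of length one sees everything to the left: moving `y` right by an integer into the
window only increases `φ`. -/
theorem le_upperEnvelope (hc : Continuous φ) (h1 : ∀ x, φ (x + 1) = φ x + 1) {y x : ℝ}
    (h : y ≤ x) : φ y ≤ upperEnvelope φ x := by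
  have hn := Nat.floor_le (sub_nonneg.2 h)
  have hn' := Nat.lt_floor_add_one (x - y)
  set n := ⌊x - y⌋₊
  have h2 : φ (y + n) ≤ upperEnvelope φ x := by
    apply le_csSup
    · exact (isCompact_Icc.bddAbove_image (f := fun s => φ (x - s)) (by fun_prop))
    · exact ⟨x - (y + n), ⟨by linarith, by linarith⟩, by simp⟩
  rw [map_add_natCast_of_map_add_one h1] at h2
  have : (0 : ℝ) ≤ n := n.cast_nonneg
  linarith

theorem lowerEnvelope_le (hc : Continuous φ) (h1 : ∀ x, φ (x + 1) = φ x + 1) {y x : ℝ}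
    (h : x ≤ y) : lowerEnvelope φ x ≤ φ y := by
  have hn := Nat.floor_le (sub_nonneg.2 h)
  have hn' := Nat.lt_floor_add_one (y - x)
  set n := ⌊y - x⌋₊
  have h2 : lowerEnvelope φ x ≤ φ (y - n) := by
    apply csInf_le
    · exact (isCompact_Icc.bddBelow_image (f := fun s => φ (x + s)) (by fun_prop))
    · exact ⟨y - n - x, ⟨by linarith, by linarith⟩, by simp⟩
  have h3 := map_add_natCast_of_map_add_one h1 (y - n) n
  rw [sub_add_cancel] at h3
  have : (0 : ℝ) ≤ n := n.cast_nonneg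
  linarith

theorem upperEnvelope_mono (hc : Continuous φ) (h1 : ∀ x, φ (x + 1) = φ x + 1) :
    Monotone (upperEnvelope φ) := fun x y hxy => by
  obtain ⟨z, hz, h⟩ := exists_eq_upperEnvelope hc x
  rw [h]
  exact le_upperEnvelope hc h1 (hz.2.trans hxy)

theorem upperEnvelope_add_one (hc : Continuous φ) (h1 : ∀ x, φ (x + 1) = φ x + 1) (x : ℝ) :
    upperEnvelope φ (x + 1) = upperEnvelope φ x + 1 := by
  apply le_antisymm
  · obtain ⟨z, hz, h⟩ := exists_eq_upperEnvelope hc (x + 1)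
    have := le_upperEnvelope hc h1 (show z - 1 ≤ x by linarith [hz.2])
    have h2 := h1 (z - 1)
    rw [sub_add_cancel] at h2
    linarith
  · obtain ⟨z, hz, h⟩ := exists_eq_upperEnvelope hc x
    rw [h, ← h1]
    exact le_upperEnvelope hc h1 (by linarith [hz.2])

theorem lowerEnvelope_add_one (hc : Continuous φ) (h1 : ∀ x, φ (x + 1) = φ x + 1) (x : ℝ) :
    lowerEnvelope φ (x + 1) = lowerEnvelope φ x + 1 := by
  apply le_antisymm
  · obtain ⟨z, hz, h⟩ := exists_eq_lowerEnvelope hc x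
    rw [h, ← h1]
    exact lowerEnvelope_le hc h1 (by linarith [hz.1])
  · obtain ⟨z, hz, h⟩ := exists_eq_lowerEnvelope hc (x + 1)
    have := lowerEnvelope_le hc h1 (show x ≤ z - 1 by linarith [hz.1])
    have h2 := h1 (z - 1)
    rw [sub_add_cancel] at h2
    linarith

theorem continuous_lowerEnvelope (hc : Continuous φ) : Continuous (lowerEnvelope φ) :=
  isCompact_Icc.continuous_sInf (f := fun x s => φ (x + s))
    (by simp only [Function.HasUncurry.uncurry, id]; fun_prop)

/-- A maximiser for a nearby `y` is either left of `x`, hence already counted at `x`, or close to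
`x`, where `hx` bounds it. -/
theorem eventually_upperEnvelope_eq (hc : Continuous φ) (h1 : ∀ x, φ (x + 1) = φ x + 1) {x : ℝ}
    (hx : ∀ᶠ y in 𝓝 x, φ y ≤ upperEnvelope φ x) (hx' : ∀ᶠ y in 𝓝 x,
      upperEnvelope φ x ≤ upperEnvelope φ y) :
    ∀ᶠ y in 𝓝 x, upperEnvelope φ y = upperEnvelope φ x := by
  obtain ⟨ε, hε, h⟩ := Metric.eventually_nhds_iff_ball.1 hx
  filter_upwards [hx', Metric.ball_mem_nhds x hε] with y hy hyε
  refine le_antisymm ?_ hy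
  obtain ⟨z, hz, hz'⟩ := exists_eq_upperEnvelope hc y
  rw [hz']
  rcases le_or_gt z x with hzx | hzx
  · exact le_upperEnvelope hc h1 hzx
  · apply h z
    rw [Metric.mem_ball, Real.dist_eq, abs_lt] at hyε ⊢
    constructor <;> linarith [hz.2]

theorem eventually_upperEnvelope_eq_of_lt (hc : Continuous φ) (h1 : ∀ x, φ (x + 1) = φ x + 1)
    {x : ℝ} (hx : φ x < upperEnvelope φ x) :
    ∀ᶠ y in 𝓝 x, upperEnvelope φ y = upperEnvelope φ x := by
  apply eventually_upperEnvelope_eq hc h1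
  · filter_upwards [hc.continuousAt.eventually_lt_const hx] with y hy using hy.le
  · obtain ⟨z, hz, hz'⟩ := exists_eq_upperEnvelope hc x
    -- The maximiser lies strictly left of `x`, so it still counts for every nearby `y`.
    have hzx : z < x := lt_of_le_of_ne hz.2 (by rintro rfl; exact hx.ne hz'.symm)
    filter_upwards [lt_mem_nhds hzx] with y hy
    rw [hz']
    exact le_upperEnvelope hc h1 hy.le

theorem eventually_lowerEnvelope_eq_of_lt (hc : Continuous φ) (h1 : ∀ x, φ (x + 1) = φ x + 1)
    {x : ℝ} (hx : lowerEnvelope φ x < φ x) :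
    ∀ᶠ y in 𝓝 x, lowerEnvelope φ y = lowerEnvelope φ x := by
  obtain ⟨w, hw, hw'⟩ := exists_eq_lowerEnvelope hc x
  have hwx : x < w := lt_of_le_of_ne hw.1 (by rintro rfl; exact hx.ne hw')
  obtain ⟨ε, hε, h⟩ := Metric.eventually_nhds_iff_ball.1 (hc.continuousAt.eventually_const_lt hx)
  filter_upwards [gt_mem_nhds hwx, Metric.ball_mem_nhds x hε] with y hy hyε
  apply le_antisymm
  · rw [hw']
    exact lowerEnvelope_le hc h1 hy.le
  · obtain ⟨z, hz, hz'⟩ := exists_eq_lowerEnvelope hc y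
    rw [hz']
    rcases le_or_gt x z with hzx | hzx
    · exact lowerEnvelope_le hc h1 hzx
    · apply (h z _).le
      rw [Metric.mem_ball, Real.dist_eq, abs_lt] at hyε ⊢
      constructor <;> linarith [hz.1]

end Envelope

/-! ### The interpolating family and its translation numbers. -/

section Truncation

/-- The map `F` cut off at height `t` above its lower envelope. -/
noncomputable def truncatedLift (F : ℝ → ℝ) (t x : ℝ) : ℝ := min (F x) (lowerEnvelope F x + t)

variable {F : ℝ → ℝ}

theorem continuous_uncurry_truncatedLift (hc : Continuous F) :
    Continuous fun z : ℝ × ℝ => truncatedLift F z.1 z.2 := by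
  have := continuous_lowerEnvelope hc
  unfold truncatedLift
  fun_prop

theorem continuous_truncatedLift (hc : Continuous F) (t : ℝ) : Continuous (truncatedLift F t) :=
  (continuous_uncurry_truncatedLift hc).comp (Continuous.prodMk_right t)

theorem truncatedLift_add_one (hc : Continuous F) (h1 : ∀ x, F (x + 1) = F x + 1) (t x : ℝ) :
    truncatedLift F t (x + 1) = truncatedLift F t x + 1 := by
  rw [truncatedLift, truncatedLift, h1, lowerEnvelope_add_one hc h1, ← min_add_add_right]
  congr 1
  ring

/-- The family of monotone maps of degree one interpolating between the envelopes of `F`. -/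
noncomputable def waterMap (hc : Continuous F) (h1 : ∀ x, F (x + 1) = F x + 1) (t : ℝ) :
    CircleDeg1Lift where
  toFun := upperEnvelope (truncatedLift F t)
  monotone' := upperEnvelope_mono (continuous_truncatedLift hc t) (truncatedLift_add_one hc h1 t)
  map_add_one' :=
    upperEnvelope_add_one (continuous_truncatedLift hc t) (truncatedLift_add_one hc h1 t)

variable (hc : Continuous F) (h1 : ∀ x, F (x + 1) = F x + 1)

theorem waterMap_apply (t x : ℝ) :
    waterMap hc h1 t x = upperEnvelope (truncatedLift F t) x := rfl

theorem continuous_uncurry_waterMap :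
    Continuous fun z : ℝ × ℝ => waterMap hc h1 z.1 z.2 := by
  apply isCompact_Icc.continuous_sSup (f := fun (z : ℝ × ℝ) s => truncatedLift F z.1 (z.2 - s))
  simp only [Function.HasUncurry.uncurry, id]
  exact (continuous_uncurry_truncatedLift hc).comp (by fun_prop :
    Continuous fun w : (ℝ × ℝ) × ℝ => (w.1.1, w.1.2 - w.2))

theorem continuous_waterMap (t : ℝ) : Continuous (waterMap hc h1 t) :=
  (continuous_uncurry_waterMap hc h1).comp (Continuous.prodMk_right t)

/-- Either the truncation is strictly below its envelope at `x`, or the cut-off is active there. In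
the latter case `F` exceeds its lower envelope, which is then locally constant, and so is the
truncation. -/
theorem eventually_waterMap_eq {t x : ℝ} (ht : 0 ≤ t) (hx : F x ≠ waterMap hc h1 t x) :
    ∀ᶠ y in 𝓝 x, waterMap hc h1 t y = waterMap hc h1 t x := by
  have hψc := continuous_truncatedLift hc t
  have hψ1 := truncatedLift_add_one hc h1 t
  rcases (le_upperEnvelope hψc hψ1 (le_refl x)).lt_or_eq with hlt | heq
  · exact eventually_upperEnvelope_eq_of_lt hψc hψ1 hlt
  · rw [waterMap_apply, ← heq] at hx
    have hlt : lowerEnvelope F x + t < F x := by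
      by_contra! h
      exact hx (min_eq_left h).symm
    have hev : ∀ᶠ y in 𝓝 x, truncatedLift F t y = upperEnvelope (truncatedLift F t) x := by
      filter_upwards [eventually_lowerEnvelope_eq_of_lt hc h1 (by linarith),
        hc.continuousAt.eventually_const_lt hlt] with y hy hy'
      rw [← heq, truncatedLift, truncatedLift, hy, min_eq_right hy'.le, min_eq_right hlt.le]
    apply eventually_upperEnvelope_eq hψc hψ1
    · filter_upwards [hev] with y hy using hy.le
    · filter_upwards [hev] with y hy
      rw [← hy]
      exact le_upperEnvelope hψc hψ1 le_rfl

theorem waterMap_zero_le (x : ℝ) : waterMap hc h1 0 x ≤ F x := by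
  obtain ⟨y, hy, h⟩ := exists_eq_upperEnvelope (continuous_truncatedLift hc 0) x
  rw [waterMap_apply, h]
  exact (min_le_right _ _).trans (by simpa using lowerEnvelope_le hc h1 hy.2)

/-- The gap between `F` and its lower envelope is continuous and periodic, hence bounded; beyond the
bound nothing is cut off. -/
theorem exists_forall_le_waterMap : ∃ t, 0 ≤ t ∧ ∀ x, F x ≤ waterMap hc h1 t x := by
  have hper : Function.Periodic (fun x => F x - lowerEnvelope F x) 1 := fun x => by
    simp only [h1, lowerEnvelope_add_one hc h1]
    ring
  obtain ⟨t, ht⟩ := (hper.compact_of_continuous one_ne_zero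
    (hc.sub (continuous_lowerEnvelope hc))).bddAbove
  have ht' : ∀ x, F x - lowerEnvelope F x ≤ t := fun x => ht ⟨x, rfl⟩
  refine ⟨t, (sub_nonneg.2 (lowerEnvelope_le hc h1 le_rfl)).trans (ht' 0), fun x => ?_⟩
  refine le_trans ?_ (le_upperEnvelope (continuous_truncatedLift hc t)
    (truncatedLift_add_one hc h1 t) (le_refl x))
  exact le_min le_rfl (by linarith [ht' x])

/-- The translation number depends continuously on a parameter. -/
theorem CircleDeg1Lift.continuous_translationNumber_of_continuous_uncurry {X : Type*}
    [TopologicalSpace X] {G : X → CircleDeg1Lift} (hG : Continuous fun z : X × ℝ => G z.1 z.2) :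
    Continuous fun t => (G t).translationNumber := by
  have hit : ∀ n : ℕ, Continuous fun t => (G t ^ n) 0 := fun n => by
    induction n with
    | zero => simpa using continuous_const
    | succ k ih =>
      have := hG.comp (continuous_id.prodMk ih)
      simpa [pow_succ', Function.comp_def] using this
  -- The error of the `n`-th approximation is at most `1 / n`, whatever the parameter.
  refine TendstoUniformly.continuous (F := fun (n : ℕ) t => (G t ^ n) 0 / n) (p := atTop) ?_
    (Eventually.frequently (Eventually.of_forall fun n => (hit n).div_const _))
  rw [Metric.tendstoUniformly_iff]
  intro ε hε
  filter_upwards [eventually_gt_atTop 0,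
    (tendsto_const_div_atTop_nhds_zero_nat (1 : ℝ)).eventually_lt_const hε] with n hn hn' t
  have hn0 : (0 : ℝ) < n := Nat.cast_pos.2 hn
  refine lt_of_le_of_lt ?_ hn'
  have := (G t).dist_pow_map_zero_mul_translationNumber_le n
  rw [dist_comm, Real.dist_eq] at this ⊢
  rw [show (G t ^ n) 0 / n - (G t).translationNumber
    = ((G t ^ n) 0 - n * (G t).translationNumber) / n by field_simp, abs_div, abs_of_pos hn0]
  gcongr
  rwa [abs_sub_comm]

theorem rotNumber_mem_Icc_of_le {F : ℝ → ℝ} {G G' : CircleDeg1Lift} (hG : ∀ x, G x ≤ F x)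
    (hG' : ∀ x, F x ≤ G' x) (x : ℝ) :
    rotNumber F x ∈ Set.Icc G.translationNumber G'.translationNumber := by
  have ht := G.tendsto_translationNumber x
  have ht' := G'.tendsto_translationNumber x
  have hle : ∀ n : ℕ, ((G ^ n) x - x) / n ≤ (F^[n] x - x) / n := fun n => by
    rw [CircleDeg1Lift.coe_pow]
    gcongr
    exact G.monotone.iterate_le_of_le hG n x
  have hle' : ∀ n : ℕ, (F^[n] x - x) / n ≤ ((G' ^ n) x - x) / n := fun n => by
    rw [CircleDeg1Lift.coe_pow]
    gcongr
    exact G'.monotone.le_iterate_of_le hG' n x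
  -- Boundedness is needed for the real-valued `limsup` to be monotone; it comes from the convergent
  -- comparison sequences.
  have hb := ht.isBoundedUnder_ge.mono_ge (Eventually.of_forall hle)
  have hb' := ht'.isBoundedUnder_le.mono_le (Eventually.of_forall hle')
  constructor
  · rw [← ht.limsup_eq]
    exact limsup_le_limsup (Eventually.of_forall hle) ht.isCoboundedUnder_le hb'
  · rw [← ht'.limsup_eq]
    exact limsup_le_limsup (Eventually.of_forall hle') hb.isCoboundedUnder_le ht'.isBoundedUnder_le

end Truncation

/-! ### Semiconjugacy of a monotone lift to a translation. -/

section Semiconjugacy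

/-- The map `x ↦ limsup (G^n x - n ρ)`. If `ρ` is the translation number of `G`, it
semiconjugates `G` to the translation by `ρ`. -/
noncomputable def rotationSemiconj (G : CircleDeg1Lift) (ρ x : ℝ) : ℝ :=
  limsup (fun n : ℕ => (G ^ n) x - n * ρ) atTop

variable {G : CircleDeg1Lift} {ρ : ℝ}

theorem pow_sub_mul_mem_Icc (hρ : G.translationNumber = ρ) (x : ℝ) (n : ℕ) :
    (G ^ n) x - n * ρ ∈ Set.Icc (⌊x⌋ - 1 : ℝ) (⌈x⌉ + 1) := by
  have h := G.dist_pow_map_zero_mul_translationNumber_le n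
  rw [hρ, Real.dist_eq, abs_le] at h
  exact ⟨by linarith [(G ^ n).le_map_of_map_zero x], by linarith [(G ^ n).map_le_of_map_zero x]⟩

theorem isBoundedUnder_le_pow_sub_mul (hρ : G.translationNumber = ρ) (x : ℝ) :
    IsBoundedUnder (· ≤ ·) atTop (fun n : ℕ => (G ^ n) x - n * ρ) :=
  isBoundedUnder_of ⟨_, fun n => (pow_sub_mul_mem_Icc hρ x n).2⟩

theorem isCoboundedUnder_le_pow_sub_mul (hρ : G.translationNumber = ρ) (x : ℝ) :
    IsCoboundedUnder (· ≤ ·) atTop (fun n : ℕ => (G ^ n) x - n * ρ) :=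
  IsBoundedUnder.isCoboundedUnder_le
    (isBoundedUnder_of ⟨_, fun n => (pow_sub_mul_mem_Icc hρ x n).1⟩)

theorem rotationSemiconj_mono (hρ : G.translationNumber = ρ) :
    Monotone (rotationSemiconj G ρ) := fun x y hxy =>
  limsup_le_limsup (Eventually.of_forall fun n => sub_le_sub_right ((G ^ n).monotone hxy) _)
    (isCoboundedUnder_le_pow_sub_mul hρ x) (isBoundedUnder_le_pow_sub_mul hρ y)

theorem rotationSemiconj_add_one (hρ : G.translationNumber = ρ) (x : ℝ) :
    rotationSemiconj G ρ (x + 1) = rotationSemiconj G ρ x + 1 := by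
  unfold rotationSemiconj
  rw [← limsup_add_const _ _ _ (isBoundedUnder_le_pow_sub_mul hρ x)
    (isCoboundedUnder_le_pow_sub_mul hρ x)]
  congr 1
  ext n
  rw [(G ^ n).map_add_one]
  ring

theorem rotationSemiconj_map (hρ : G.translationNumber = ρ) (x : ℝ) :
    rotationSemiconj G ρ (G x) = rotationSemiconj G ρ x + ρ := by
  unfold rotationSemiconj
  rw [← limsup_nat_add (fun n : ℕ => (G ^ n) x - n * ρ) 1, ← limsup_add_const atTop
    (fun n : ℕ => (G ^ (n + 1)) x - (n + 1 : ℕ) * ρ) ρ]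
  · congr 1
    ext n
    rw [pow_succ, CircleDeg1Lift.mul_apply]
    push_cast
    ring
  · exact isBoundedUnder_of ⟨_, fun n => (pow_sub_mul_mem_Icc hρ x (n + 1)).2⟩
  · exact IsBoundedUnder.isCoboundedUnder_le
      (isBoundedUnder_of ⟨_, fun n => (pow_sub_mul_mem_Icc hρ x (n + 1)).1⟩)

theorem map_add_intCast_of_map_add_one {φ : ℝ → ℝ} (h1 : ∀ x, φ (x + 1) = φ x + 1) (x : ℝ)
    (m : ℤ) : φ (x + m) = φ x + m := by
  obtain ⟨n, rfl | rfl⟩ := m.eq_nat_or_neg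
  · exact_mod_cast map_add_natCast_of_map_add_one h1 x n
  · have := map_add_natCast_of_map_add_one h1 (x + (-n : ℤ)) n
    push_cast at this ⊢
    rw [neg_add_cancel_right] at this
    linarith

theorem coe_eq_coe_iff_exists_int {x y : ℝ} :
    (x : UnitAddCircle) = (y : UnitAddCircle) ↔ ∃ m : ℤ, x = y + m := by
  rw [QuotientAddGroup.eq_iff_sub_mem, AddSubgroup.mem_zmultiples_iff]
  simp only [zsmul_eq_mul, mul_one]
  exact exists_congr fun m => by constructor <;> intro h <;> linarith

/-- A monotone function with dense range has no jumps. The range contains `c + n ρ + m` for all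
natural `n` and integers `m`, which is dense because `ρ` is irrational. -/
theorem rotationSemiconj_continuous (hρ : G.translationNumber = ρ) (hirr : Irrational ρ) :
    Continuous (rotationSemiconj G ρ) := by
  refine (rotationSemiconj_mono hρ).continuous_of_denseRange ?_
  have hd : DenseRange (fun n : ℕ => n • (ρ : UnitAddCircle)) := by
    rw [← denseRange_zsmul_iff_nsmul]
    exact AddCircle.denseRange_zsmul_coe_iff.2 (by simpa using hirr)
  set c := rotationSemiconj G ρ 0
  have hd' : Dense (Set.range fun n : ℕ => (c : UnitAddCircle) + n • (ρ : UnitAddCircle)) :=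
    (Homeomorph.addLeft (c : UnitAddCircle)).surjective.denseRange.comp hd
      (Homeomorph.addLeft (c : UnitAddCircle)).continuous
  have hpre := hd'.preimage (QuotientAddGroup.isOpenMap_coe (N := AddSubgroup.zmultiples (1 : ℝ)))
  refine hpre.mono ?_
  rintro y ⟨n, hn⟩
  have hit : ∀ n : ℕ, rotationSemiconj G ρ ((G ^ n) 0) = c + n * ρ := fun n => by
    induction n with
    | zero => simp [c]
    | succ k ih =>
      rw [pow_succ', CircleDeg1Lift.mul_apply, rotationSemiconj_map hρ, ih]
      push_cast
      ring
  have hn' : ((c + n * ρ : ℝ) : UnitAddCircle) = (y : UnitAddCircle) := by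
    rw [AddCircle.coe_add, ← nsmul_eq_mul, AddCircle.coe_nsmul]
    exact hn
  obtain ⟨m, hm⟩ := coe_eq_coe_iff_exists_int.1 hn'.symm
  exact ⟨(G ^ n) 0 + m, by
    rw [map_add_intCast_of_map_add_one (rotationSemiconj_add_one hρ), hit, hm]⟩

end Semiconjugacy

/-! ### Ergodic push-forwards, circle maps from lifts, and the notion of rotation factor. -/

theorem ergodic_map_of_ae_semiconj {α β : Type*} [MeasurableSpace α] [MeasurableSpace β]
    {ν : Measure α} {R : α → α} {f : β → β} {k : α → β} (hR : Ergodic R ν) (hk : Measurable k)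
    (hf : Measurable f) (hcomm : ∀ᵐ a ∂ν, k (R a) = f (k a)) : Ergodic f (ν.map k) := by
  have hmp : MeasurePreserving k ν (ν.map k) := ⟨hk, rfl⟩
  refine ⟨⟨hf, ?_⟩, ⟨fun s hs hfs => ?_⟩⟩
  · rw [Measure.map_map hf hk, ← Measure.map_congr (f := k ∘ R) (g := f ∘ k) hcomm,
      ← Measure.map_map hk hR.measurable, hR.map_eq]
  · rw [← hmp.aeconst_preimage hs.nullMeasurableSet]
    refine hR.quasiErgodic.aeconst_set₀ (hk hs).nullMeasurableSet ?_
    filter_upwards [hcomm] with a ha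
    apply propext
    change k (R a) ∈ s ↔ k a ∈ s
    rw [ha]
    exact Set.ext_iff.1 hfs (k a)

theorem UnitAddCircle.volume_eq_zero_of_countable {s : Set UnitAddCircle} (hs : s.Countable) :
    volume s = 0 := by
  have : NullSingletonClass (volume : Measure UnitAddCircle) := ⟨fun θ => by
    rw [← Metric.closedBall_zero, AddCircle.volume_closedBall]
    simp⟩
  exact hs.measure_zero _

theorem IsDegreeOneLift.exists_of_continuous {H : ℝ → ℝ} (hc : Continuous H)
    (h1 : ∀ x, H (x + 1) = H x + 1) :
    ∃ h : UnitAddCircle → UnitAddCircle, Continuous h ∧ IsDegreeOneLift h H := by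
  have hper : Function.Periodic (fun x => (H x : UnitAddCircle)) 1 := fun x => by
    simp only [h1, AddCircle.coe_add_period]
  have hlift : ∀ x : ℝ, hper.lift (x : UnitAddCircle) = (H x : UnitAddCircle) := hper.lift_coe
  refine ⟨hper.lift, ?_, hc, h1, hlift⟩
  apply continuous_coinduced_dom.2
  exact (AddCircle.continuous_mk' 1).comp hc

/-- The set `U` carries, through the monotone map `h`, a copy of the rotation by `ρ`, and `μ` is the
measure corresponding to the Lebesgue measure. -/
structure IsRotationFactor (f : UnitAddCircle → UnitAddCircle) (F : ℝ → ℝ) (ρ : ℝ)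
    (U : Set UnitAddCircle) (h : UnitAddCircle → UnitAddCircle)
    (μ : Measure UnitAddCircle) : Prop where
  measurableSet : MeasurableSet U
  image_eq : f '' U = U
  nondecreasing : IsNondecreasingDegreeOne h
  isProbabilityMeasure : IsProbabilityMeasure μ
  ergodic : Ergodic f μ
  measure_eq_one : μ U = 1
  rotNumber_eq : ∀ x : ℝ, (x : UnitAddCircle) ∈ closure U → rotNumber F x = ρ
  isEmbedding : IsEmbedding (U.domRestrict h)
  dense_image : Dense (h '' U)
  image_image : circleRot ρ '' (h '' U) = h '' U
  semiconj : ∀ θ ∈ U, h (f θ) = circleRot ρ (h θ)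

/-! ### Construction of the support and of its rotation factor. -/

section Support

/-- The points of the circle whose orbit under the rotation by `ρ` avoids the points with several
preimages under `H`. -/
def regularValues (H : ℝ → ℝ) (ρ : ℝ) : Set UnitAddCircle :=
  {η | ∀ n : ℤ, η + n • (ρ : UnitAddCircle) ∉
    ((↑) : ℝ → UnitAddCircle) '' {c | ∃ x y, x < y ∧ H x = c ∧ H y = c}}

variable {H : ℝ → ℝ} {ρ : ℝ}

/-- A monotone function takes only countably many values more than once, and each is removed along a
countable orbit. -/
theorem countable_compl_regularValues (hH : Monotone H) : (regularValues H ρ)ᶜ.Countable := by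
  have hD := hH.countable_setOfPred_two_preimages.image ((↑) : ℝ → UnitAddCircle)
  refine (Set.countable_iUnion fun n : ℤ =>
    hD.preimage (add_left_injective (n • (ρ : UnitAddCircle)))).mono ?_
  intro η hη
  simp only [regularValues, Set.mem_compl_iff, Set.mem_ofPred_eq, not_forall, not_not] at hη
  exact Set.mem_iUnion.2 hη

theorem add_mem_regularValues_iff {η : UnitAddCircle} :
    η + (ρ : UnitAddCircle) ∈ regularValues H ρ ↔ η ∈ regularValues H ρ := by
  constructor
  · intro h n
    have := h (n - 1)
    rwa [add_assoc, sub_smul, one_smul, add_sub_cancel] at this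
  · intro h n
    have := h (n + 1)
    rwa [add_smul, one_smul, add_comm (n • _), ← add_assoc] at this

theorem eq_of_mem_regularValues {x y : ℝ} (hx : (H x : UnitAddCircle) ∈ regularValues H ρ)
    (hxy : H x = H y) : x = y := by
  have h0 := hx 0
  rw [zero_smul, add_zero] at h0
  by_contra hne
  rcases lt_or_gt_of_ne hne with hlt | hlt
  · exact h0 ⟨H x, ⟨x, y, hlt, rfl, hxy.symm⟩, rfl⟩
  · exact h0 ⟨H x, ⟨y, x, hlt, hxy.symm, rfl⟩, rfl⟩

end Support

theorem exists_isRotationFactor {f : UnitAddCircle → UnitAddCircle} (hf : Continuous f)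
    {F : ℝ → ℝ} (hF : IsDegreeOneLift f F) {ρ : ℝ} (hirr : Irrational ρ) {G : CircleDeg1Lift}
    (hGc : Continuous G) (hρ : G.translationNumber = ρ)
    (hFG : ∀ x, F x ≠ G x → ∀ᶠ y in 𝓝 x, G y = G x) :
    ∃ U h μ, IsRotationFactor f F ρ U h μ := by
  set H := rotationSemiconj G ρ
  have Hmono : Monotone H := rotationSemiconj_mono hρ
  have H1 : ∀ x, H (x + 1) = H x + 1 := rotationSemiconj_add_one hρ
  have Hc : Continuous H := rotationSemiconj_continuous hρ hirr
  have HG : ∀ x, H (G x) = H x + ρ := rotationSemiconj_map hρ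
  obtain ⟨h, hc, hlift⟩ := IsDegreeOneLift.exists_of_continuous Hc H1
  set E := regularValues H ρ
  have hEc : Eᶜ.Countable := countable_compl_regularValues Hmono
  have hEm : MeasurableSet E := hEc.measurableSet.of_compl
  have hEae : ∀ᵐ η ∂(volume : Measure UnitAddCircle), η ∈ E :=
    UnitAddCircle.volume_eq_zero_of_countable hEc
  have hsurj : Function.Surjective h := fun η => by
    induction η using QuotientAddGroup.induction_on with | _ c => ?_
    have hsH : Function.Surjective H :=
      (CircleDeg1Lift.continuous_iff_surjective ⟨⟨H, Hmono⟩, H1⟩).1 Hc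
    obtain ⟨x, rfl⟩ := hsH c
    exact ⟨x, hlift.semiconj x⟩
  have hinj : Set.InjOn h (h ⁻¹' E) := fun θ hθ θ' hθ' heq => by
    induction θ using QuotientAddGroup.induction_on with | _ x => ?_
    induction θ' using QuotientAddGroup.induction_on with | _ y => ?_
    rw [hlift.semiconj, hlift.semiconj] at heq
    obtain ⟨m, hm⟩ := coe_eq_coe_iff_exists_int.1 heq
    rw [Set.mem_preimage, hlift.semiconj] at hθ
    rw [← map_add_intCast_of_map_add_one H1] at hm
    exact coe_eq_coe_iff_exists_int.2 ⟨m, eq_of_mem_regularValues hθ hm⟩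
  -- Otherwise `G` is constant near `x`, hence so is `H = H ∘ G - ρ`, contradicting uniqueness of
  -- the preimage of `H x`.
  have hEq : ∀ x : ℝ, (x : UnitAddCircle) ∈ h ⁻¹' E → F x = G x := fun x hx => by
    by_contra hne
    rw [Set.mem_preimage, hlift.semiconj] at hx
    have h2 : ∀ᶠ y in 𝓝 x, y = x := by
      filter_upwards [hFG x hne] with y hy
      refine (eq_of_mem_regularValues hx ?_).symm
      have := HG y
      rw [hy, HG] at this
      linarith
    have h3 : ∀ᶠ y in 𝓝[≠] x, False := by
      filter_upwards [h2.filter_mono nhdsWithin_le_nhds, self_mem_nhdsWithin] with y hy hy'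
      exact hy' hy
    exact h3.exists.elim fun _ => id
  have hsemi : ∀ θ ∈ h ⁻¹' E, h (f θ) = circleRot ρ (h θ) := fun θ hθ => by
    induction θ using QuotientAddGroup.induction_on with | _ x => ?_
    rw [hF.semiconj, hlift.semiconj, hEq x hθ, HG, hlift.semiconj, AddCircle.coe_add, circleRot]
  have himg : h '' (h ⁻¹' E) = E := Set.image_preimage_eq E hsurj
  have hmaps : ∀ θ ∈ h ⁻¹' E, f θ ∈ h ⁻¹' E := fun θ hθ => by
    rw [Set.mem_preimage, hsemi θ hθ]
    exact add_mem_regularValues_iff.2 hθ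
  have hrotE : circleRot ρ '' E = E := by
    ext η
    constructor
    · rintro ⟨ζ, hζ, rfl⟩
      exact add_mem_regularValues_iff.2 hζ
    · intro hη
      refine ⟨η - ρ, ?_, sub_add_cancel η _⟩
      rw [← sub_add_cancel η (ρ : UnitAddCircle)] at hη
      exact add_mem_regularValues_iff.1 hη
  have hUm : MeasurableSet (h ⁻¹' E) := hc.measurable hEm
  have hme : MeasurableEmbedding ((h ⁻¹' E).domRestrict h) :=
    hc.continuousOn.measurableEmbedding hUm hinj
  -- The inverse of `h` over `E`; the default value `0` is taken only on the null set outside `E`.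
  set k : UnitAddCircle → UnitAddCircle :=
    Function.extend ((h ⁻¹' E).domRestrict h) Subtype.val (fun _ => 0)
  have hkm : Measurable k := hme.measurable_extend measurable_subtype_coe measurable_const
  have hk : ∀ θ ∈ h ⁻¹' E, k (h θ) = θ := fun θ hθ =>
    hme.injective.extend_apply Subtype.val (fun _ => 0) ⟨θ, hθ⟩
  have : IsProbabilityMeasure (volume : Measure UnitAddCircle) := ⟨UnitAddCircle.measure_univ⟩
  have hprob : IsProbabilityMeasure (Measure.map k volume) :=
    Measure.isProbabilityMeasure_map hkm.aemeasurable
  refine ⟨h ⁻¹' E, h, Measure.map k volume, hUm, ?_, ⟨hc, H, hlift, Hmono⟩, hprob, ?_, ?_, ?_, ?_,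
    ?_, ?_, hsemi⟩
  · ext θ
    constructor
    · rintro ⟨θ', hθ', rfl⟩
      exact hmaps θ' hθ'
    · intro hθ
      have h2 : h θ ∈ circleRot ρ '' E := hrotE.symm ▸ hθ
      obtain ⟨η, hη, heq⟩ := h2
      obtain ⟨θ', rfl⟩ := hsurj η
      exact ⟨θ', hη, hinj (hmaps θ' hη) hθ ((hsemi θ' hη).trans heq)⟩
  · have herg : Ergodic (circleRot ρ) (volume : Measure UnitAddCircle) := by
      refine AddCircle.ergodic_add_right.2 (AddCircle.denseRange_zsmul_iff.1 ?_)
      exact AddCircle.denseRange_zsmul_coe_iff.2 (by simpa using hirr)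
    refine ergodic_map_of_ae_semiconj herg hkm hf.measurable ?_
    filter_upwards [hEae] with η hη
    obtain ⟨θ, rfl⟩ := hsurj η
    rw [hk θ hη, ← hsemi θ hη, hk _ (hmaps θ hη)]
  · rw [← prob_compl_eq_zero_iff hUm, Measure.map_apply hkm hUm.compl]
    refine measure_mono_null (fun η hη => ?_) hEae
    obtain ⟨θ, rfl⟩ := hsurj η
    intro hθ
    apply hη
    rw [hk θ hθ]
    exact hθ
  · intro x hx
    set V : Set ℝ := (↑) ⁻¹' (h ⁻¹' E) with hV
    have hxV : x ∈ closure V := by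
      rw [hV, ← (QuotientAddGroup.isOpenMap_coe
        (N := AddSubgroup.zmultiples (1 : ℝ))).preimage_closure_eq_closure_preimage
        (AddCircle.continuous_mk' 1)]
      exact hx
    have hVF : Set.MapsTo F V V := fun y hy => by
      rw [hV, Set.mem_preimage, ← hF.semiconj]
      exact hmaps _ hy
    have hcl : Set.MapsTo F (closure V) (closure V) := hVF.closure hF.continuous
    have heq : Set.EqOn F G (closure V) := Set.EqOn.closure hEq hF.continuous hGc
    have hit : ∀ n : ℕ, F^[n] x = (G ^ n) x := fun n => by
      induction n with
      | zero => rfl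
      | succ k ih =>
        rw [Function.iterate_succ_apply', heq (hcl.iterate k hxV), ih, pow_succ',
          CircleDeg1Lift.mul_apply]
    unfold rotNumber
    simp only [hit]
    rw [(G.tendsto_translationNumber x).limsup_eq, hρ]
  -- Compactness makes `h` closed, and closedness survives restriction to a full preimage, so the
  -- inverse is continuous.
  · have hcl : IsClosedMap (E.restrictPreimage h) := hc.isClosedMap.restrictPreimage E
    have hemb := IsClosedEmbedding.of_continuous_injective_isClosedMap
      hc.restrictPreimage (fun a b hab => Subtype.ext (hinj a.2 b.2 (congrArg Subtype.val hab))) hcl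
    exact IsEmbedding.subtypeVal.comp hemb.isEmbedding
  · rw [himg]
    exact Measure.dense_of_ae hEae
  · rw [himg]
    exact hrotE

/-! ### Transfer of attracting sets from the rotation to `f`. -/

section Transfer

variable {K : Set ℝ} {f : UnitAddCircle → UnitAddCircle} {F : ℝ → ℝ} {ρ : ℝ}
  {U : Set UnitAddCircle} {h : UnitAddCircle → UnitAddCircle} {μ : Measure UnitAddCircle}
  {p : K → K} {q : UnitAddCircle → ℝ} {hpq : ∀ (θ : UnitAddCircle) (x : K), (p x : ℝ) * q θ ∈ K}

theorem IsRotationFactor.injOn (hU : IsRotationFactor f F ρ U h μ) : Set.InjOn h U :=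
  Set.injOn_iff_injective.2 hU.isEmbedding.injective

theorem IsRotationFactor.mapsTo (hU : IsRotationFactor f F ρ U h μ) : Set.MapsTo f U U :=
  Set.mapsTo_iff_image_subset.2 hU.image_eq.subset

theorem IsRotationFactor.rotationForced_apply (hU : IsRotationFactor f F ρ U h μ)
    {θ : UnitAddCircle} (hθ : θ ∈ U) (x : K) :
    rotationForced ρ p q hpq h U (h θ, x) =
      (h (f θ), (skewProduct f p q hpq (θ, x)).2) := by
  have hinv : Function.invFunOn h U (h θ) = θ := hU.injOn.leftInvOn_invFunOn hθ
  simp only [rotationForced, skewProduct, hU.semiconj θ hθ, hinv]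

theorem IsRotationFactor.rotationForced_iterate (hU : IsRotationFactor f F ρ U h μ)
    {θ : UnitAddCircle} (hθ : θ ∈ U) (x : K) (n : ℕ) :
    (rotationForced ρ p q hpq h U)^[n] (h θ, x) =
      (h (f^[n] θ), ((skewProduct f p q hpq)^[n] (θ, x)).2) := by
  induction n generalizing θ x with
  | zero => rfl
  | succ k ih =>
    rw [Function.iterate_succ_apply, hU.rotationForced_apply hθ, ih (hU.mapsTo hθ)]
    rfl

theorem skewProduct_iterate_fst (θ : UnitAddCircle) (x : K) (n : ℕ) :
    ((skewProduct f p q hpq)^[n] (θ, x)).1 = f^[n] θ := by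
  induction n generalizing θ x with
  | zero => rfl
  | succ k ih =>
    rw [Function.iterate_succ_apply, Function.iterate_succ_apply]
    exact ih _ _

/-- Two orbits starting in one fibre always share their base point, so only fibre coordinates matter
and `h` need not preserve distances. -/
theorem IsRotationFactor.dist_skewProduct_iterate (hU : IsRotationFactor f F ρ U h μ)
    {θ : UnitAddCircle} (hθ : θ ∈ U) (x z : K) (n : ℕ) :
    dist ((skewProduct f p q hpq)^[n] (θ, x)) ((skewProduct f p q hpq)^[n] (θ, z)) =
      dist ((rotationForced ρ p q hpq h U)^[n] (h θ, x))
        ((rotationForced ρ p q hpq h U)^[n] (h θ, z)) := by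
  rw [hU.rotationForced_iterate hθ, hU.rotationForced_iterate hθ, Prod.dist_eq, Prod.dist_eq,
    skewProduct_iterate_fst, skewProduct_iterate_fst, dist_self, dist_self]

theorem IsRotationFactor.generatesAttractingSet_comp (hU : IsRotationFactor f F ρ U h μ)
    {φ : UnitAddCircle → Set K}
    (hφ : GeneratesAttractingSet (circleRot ρ) (rotationForced ρ p q hpq h U) (h '' U) φ) :
    GeneratesAttractingSet f (skewProduct f p q hpq) U (φ ∘ h) where
  measurableSet_support := hU.measurableSet
  image_support := hU.image_eq
  exists_ergodic := ⟨μ, hU.isProbabilityMeasure, hU.ergodic, hU.measure_eq_one⟩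
  image_graph := by
    apply Set.Subset.antisymm
    · rintro _ ⟨⟨θ, x⟩, ⟨hθ, hx⟩, rfl⟩
      have hmem : rotationForced ρ p q hpq h U (h θ, x) ∈ corrGraph (h '' U) φ :=
        hφ.image_graph ▸ Set.mem_image_of_mem _ ⟨Set.mem_image_of_mem h hθ, hx⟩
      rw [hU.rotationForced_apply hθ] at hmem
      exact ⟨hU.mapsTo hθ, hmem.2⟩
    · rintro ⟨θ, x⟩ ⟨hθ, hx⟩
      have hmem : (h θ, x) ∈ rotationForced ρ p q hpq h U '' corrGraph (h '' U) φ :=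
        hφ.image_graph.symm ▸ ⟨Set.mem_image_of_mem h hθ, hx⟩
      obtain ⟨⟨_, y⟩, ⟨⟨θ', hθ', rfl⟩, hy⟩, heq⟩ := hmem
      rw [hU.rotationForced_apply hθ', Prod.mk.injEq] at heq
      refine ⟨(θ', y), ⟨hθ', hy⟩, Prod.ext ?_ heq.2⟩
      exact hU.injOn (hU.mapsTo hθ') hθ heq.1
  attracts := fun θ hθ => by
    obtain ⟨A, hA, hpos, hattr⟩ := hφ.attracts (h θ) (Set.mem_image_of_mem h hθ)
    refine ⟨A, hA, hpos, fun x hx => ?_⟩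
    obtain ⟨z, hz, ht⟩ := hattr x hx
    refine ⟨z, hz, ht.congr fun n => ?_⟩
    rw [hU.dist_skewProduct_iterate hθ]

theorem GeneratesAttractingSet.nonempty_corrGraph {g : UnitAddCircle → UnitAddCircle}
    {T : UnitAddCircle × K → UnitAddCircle × K} {φ : UnitAddCircle → Set K}
    (hφ : GeneratesAttractingSet g T U φ) : (corrGraph U φ).Nonempty := by
  obtain ⟨ν, -, -, hν⟩ := hφ.exists_ergodic
  obtain ⟨θ, hθ⟩ : U.Nonempty := nonempty_of_measure_ne_zero (μ := ν) (by simp [hν])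
  obtain ⟨A, -, hpos, hattr⟩ := hφ.attracts θ hθ
  obtain ⟨_, x, hx, -⟩ := nonempty_of_measure_ne_zero hpos.ne'
  obtain ⟨z, hz, -⟩ := hattr x hx
  exact ⟨(θ, z), hθ, hz⟩

theorem closure_corrGraph_subset (U : Set UnitAddCircle) (φ : UnitAddCircle → Set K) :
    closure (corrGraph U φ) ⊆ Prod.fst ⁻¹' closure U :=
  closure_minimal (fun _ hz => subset_closure hz.1) (isClosed_closure.preimage continuous_fst)

end Transfer

/-! ### Size of the irrational rotation set. -/

section RotationSet

variable {f : UnitAddCircle → UnitAddCircle} {F : ℝ → ℝ}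

theorem IsRotationFactor.mem_irrRotSet {ρ : ℝ} {U : Set UnitAddCircle}
    {h : UnitAddCircle → UnitAddCircle} {μ : Measure UnitAddCircle}
    (hU : IsRotationFactor f F ρ U h μ) (hirr : Irrational ρ) : ρ ∈ irrRotSet F := by
  obtain ⟨θ, hθ⟩ : U.Nonempty := nonempty_of_measure_ne_zero (μ := μ) (by simp [hU.measure_eq_one])
  induction θ using QuotientAddGroup.induction_on with | _ x => ?_
  exact ⟨⟨x, hU.rotNumber_eq x (subset_closure hθ)⟩, hirr⟩

/-- The rotation set is contained in a compact interval all of whose irrational points are realised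
by rotation factors. -/
theorem exists_Icc_rotSet (hf : Continuous f) (hF : IsDegreeOneLift f F) :
    ∃ a b : ℝ, rotSet F ⊆ Set.Icc a b ∧
      ∀ ρ ∈ Set.Icc a b, Irrational ρ → ∃ U h μ, IsRotationFactor f F ρ U h μ := by
  obtain ⟨t, ht, hle⟩ := exists_forall_le_waterMap hF.continuous hF.map_add_one
  set G := waterMap hF.continuous hF.map_add_one
  refine ⟨(G 0).translationNumber, (G t).translationNumber, ?_, fun ρ hρ hirr => ?_⟩
  · rintro _ ⟨x, rfl⟩
    exact rotNumber_mem_Icc_of_le (waterMap_zero_le _ _) hle x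
  · obtain ⟨s, hs, hsρ⟩ := intermediate_value_Icc ht
      (CircleDeg1Lift.continuous_translationNumber_of_continuous_uncurry
        (continuous_uncurry_waterMap hF.continuous hF.map_add_one)).continuousOn hρ
    exact exists_isRotationFactor hf hF hirr (continuous_waterMap _ _ s) hsρ
      fun x hx => eventually_waterMap_eq _ _ hs.1 hx

/-- All irrationals of a non-degenerate interval are realised, so countability would make the
interval itself countable. -/
theorem not_countable_irrRotSet (hf : Continuous f) (hF : IsDegreeOneLift f F)
    (hnt : (rotSet F).Nontrivial) : ¬ (irrRotSet F).Countable := by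
  obtain ⟨a, b, hsub, hfac⟩ := exists_Icc_rotSet hf hF
  have hab : a < b := by
    obtain ⟨x, hx, y, hy, hxy⟩ := hnt.exists_lt
    exact (hsub hx).1.trans_lt (hxy.trans_le (hsub hy).2)
  intro hcount
  have hQ : (Set.range ((↑) : ℚ → ℝ)).Countable := Set.countable_range _
  have hIoo : (Set.Ioo a b).Countable := (hcount.union hQ).mono fun ρ hρ => by
    by_cases hirr : Irrational ρ
    · obtain ⟨U, h, μ, hU⟩ := hfac ρ (Set.Ioo_subset_Icc_self hρ) hirr
      exact Or.inl (hU.mem_irrRotSet hirr)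
    · exact Or.inr (not_not.1 hirr)
  exact hab.not_ge (Cardinal.Real.Ioo_countable_iff.1 hIoo)

end RotationSet

/-! ### The theorem. -/

theorem mainTheorem1
    (f : UnitAddCircle → UnitAddCircle) (hf : Continuous f)
    (F : ℝ → ℝ) (hF : IsDegreeOneLift f F)
    (K : Set ℝ) (hK_closed : IsClosed K) (hK_interval : K.OrdConnected) (hK_zero : (0 : ℝ) ∈ K)
    (p : K → K) (hp : Continuous p)
    (q : UnitAddCircle → ℝ) (hq : Continuous q)
    (hpq : ∀ (θ : UnitAddCircle) (x : K), (p x : ℝ) * q θ ∈ K) :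
    ∃ (U : ℝ → Set UnitAddCircle) (h : ℝ → UnitAddCircle → UnitAddCircle)
      (μ : ℝ → Measure UnitAddCircle),
      (∀ ρ ∈ irrRotSet F,
        MeasurableSet (U ρ) ∧ f '' U ρ = U ρ ∧
        IsNondecreasingDegreeOne (h ρ) ∧
        IsProbabilityMeasure (μ ρ) ∧ Ergodic f (μ ρ) ∧ μ ρ (U ρ) = 1 ∧
        (∀ x : ℝ, (x : UnitAddCircle) ∈ closure (U ρ) → rotNumber F x = ρ) ∧
        IsEmbedding ((U ρ).domRestrict (h ρ)) ∧
        Dense (h ρ '' U ρ) ∧ circleRot ρ '' (h ρ '' U ρ) = h ρ '' U ρ ∧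
        (∀ θ ∈ U ρ, h ρ (f θ) = circleRot ρ (h ρ θ))) ∧
      (irrRotSet F).PairwiseDisjoint (fun ρ => closure (U ρ)) ∧
      (∀ ρ ∈ irrRotSet F, ∀ φ : UnitAddCircle → Set K,
        GeneratesAttractingSet (circleRot ρ) (rotationForced ρ p q hpq (h ρ) (U ρ))
          (h ρ '' U ρ) φ →
        GeneratesAttractingSet f (skewProduct f p q hpq) (U ρ) (φ ∘ h ρ)) ∧
      ((∀ ρ ∈ irrRotSet F, ∃ φ : UnitAddCircle → Set K,
          GeneratesAttractingSet (circleRot ρ) (rotationForced ρ p q hpq (h ρ) (U ρ))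
            (h ρ '' U ρ) φ) →
        (rotSet F).Nontrivial →
        ∃ 𝒜 : Set (Set (UnitAddCircle × K)),
          ¬ 𝒜.Countable ∧ 𝒜.PairwiseDisjoint id ∧
          ∀ A ∈ 𝒜, IsAttractingSet f (skewProduct f p q hpq) A) := by
  obtain ⟨a, b, hsub, hfac⟩ := exists_Icc_rotSet hf hF
  have hex : ∀ ρ : ℝ, ∃ U h μ, ρ ∈ irrRotSet F → IsRotationFactor f F ρ U h μ := fun ρ => by
    by_cases hρ : ρ ∈ irrRotSet F
    · obtain ⟨U, h, μ, hU⟩ := hfac ρ (hsub hρ.1) hρ.2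
      exact ⟨U, h, μ, fun _ => hU⟩
    · exact ⟨∅, id, 0, fun hρ' => absurd hρ' hρ⟩
  choose U h μ hU using hex
  have hdisj : (irrRotSet F).PairwiseDisjoint (fun ρ => closure (U ρ)) := by
    intro ρ hρ ρ' hρ' hne
    refine Set.disjoint_left.2 fun θ hθ hθ' => hne ?_
    induction θ using QuotientAddGroup.induction_on with | _ x => ?_
    rw [← (hU ρ hρ).rotNumber_eq x hθ, (hU ρ' hρ').rotNumber_eq x hθ']
  refine ⟨U, h, μ, fun ρ hρ => ?_, hdisj,
    fun ρ hρ φ hφ => (hU ρ hρ).generatesAttractingSet_comp hφ, fun hall hnt => ?_⟩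
  · have hUρ := hU ρ hρ
    exact ⟨hUρ.measurableSet, hUρ.image_eq, hUρ.nondecreasing, hUρ.isProbabilityMeasure,
      hUρ.ergodic, hUρ.measure_eq_one, hUρ.rotNumber_eq, hUρ.isEmbedding, hUρ.dense_image,
      hUρ.image_image, hUρ.semiconj⟩
  · choose! φ hφ using hall
    have hgen : ∀ ρ ∈ irrRotSet F,
        GeneratesAttractingSet f (skewProduct f p q hpq) (U ρ) (φ ρ ∘ h ρ) :=
      fun ρ hρ => (hU ρ hρ).generatesAttractingSet_comp (hφ ρ hρ)
    set A : ℝ → Set (UnitAddCircle × K) := fun ρ => closure (corrGraph (U ρ) (φ ρ ∘ h ρ))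
    have hAdisj : (irrRotSet F).PairwiseDisjoint A := fun ρ hρ ρ' hρ' hne =>
      ((hdisj hρ hρ' hne).preimage Prod.fst).mono (closure_corrGraph_subset _ _)
        (closure_corrGraph_subset _ _)
    have hAne : ∀ ρ ∈ irrRotSet F, (A ρ).Nonempty := fun ρ hρ =>
      (hgen ρ hρ).nonempty_corrGraph.closure
    -- Being nonempty as well as disjoint, the closures are distinct, so the family is as large as
    -- its index set.
    have hAinj : Set.InjOn A (irrRotSet F) := fun ρ hρ ρ' hρ' heq => by
      by_contra hne
      have hd := hAdisj hρ hρ' hne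
      rw [Function.onFun, ← heq, disjoint_self] at hd
      exact (hAne ρ hρ).ne_empty hd
    refine ⟨A '' irrRotSet F, fun hcount => ?_, ?_, ?_⟩
    · exact not_countable_irrRotSet hf hF hnt (Set.countable_of_injective_of_countable_image hAinj
        hcount)
    · rintro _ ⟨ρ, hρ, rfl⟩ _ ⟨ρ', hρ', rfl⟩ hne
      exact hAdisj hρ hρ' fun heq => hne (heq ▸ rfl)
    · rintro _ ⟨ρ, hρ, rfl⟩
      exact ⟨U ρ, φ ρ ∘ h ρ, hgen ρ hρ, rfl⟩
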